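/- **Setting.** There are $n$ bidders. Bidder $i$ has a private signal $s_i$ in an ordered signal space $S_i$ with least element $0$, and a private monotone valuation function $v_i:\mathbf S=S_1\times\dots\times S_n\to\mathbb R_{\ge 0}$ from a valuation space $V_i$; write $\mathbf V=V_1\times\dots\times V_n$. A valuation $v$ is *$d$-critical* if $|\{j : v(s_{-j},0_j)<v(s)\}|\le d$ for every $s\in\mathbf S$. The sets of bidders that can be served together are the independent sets $\mathcal I$ of a matroid on $[n]$. A mechanism maps reports $(s,v)\in\mathbf S\times\mathbf V$ to a random served set and to payments $p_i(s,v)$; $x_i(s,v)$ denotes the probability that $i$ is served. It is *feasible* if it only ever serves sets in $\mathcal I$. It is *EPIC-IR* if for all $i$, $s\in\mathbf S$, $v\in\mathbf V$, $s_i'\in S_i$, $v_i'\in V_i$, $$x_i(s,v)v_i(s)-p_i(s,v)\ \ge\ x_i(s_{-i},s_i',v_{-i},v_i')\,v_i(s)-p_i(s_{-i},s_i',v_{-i},v_i')\quad\text{and}\quad x_i(s,v)v_i(s)-p_i(s,v)\ge 0 .$$ Its welfare at $(s,v)$ is $\sum_i x_i(s,v)v_i(s)$, and $\mathrm{OPT}(s,v)=\max_{I\in\mathcal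 I}\sum_{i\in I}v_i(s)$. **Candidate Partitioning mechanism.** For weights $w:[n]\to\mathbb R$, let $\mathrm{greedy}(w)$ be the set obtained by going over the bidders by decreasing weight (ties in favour of lower index) and adding each bidder that keeps the set independent. At reports $(s,v)$, for a bidder $i$ and a number $t\ge 0$, let $w_{i,t}(i)=t$ and $w_{i,t}(j)=v_j(s_{-i},0_i)$ for $j\ne i$, and let $\chi_i(t)=\frac1{d+1}$ if $i\in\mathrm{greedy}(w_{i,t})$ and $\chi_i(t)=0$ otherwise. Bidder $i$ is a *candidate* if $i\in \mathrm{greedy}(w_{i,v_i(s)})$. Partition the set $\mathcal C$ of candidates into at most $d+1$ independent sets, serve each of them with probability $\frac1{d+1}$ (and nobody with the remaining probability), and charge $p_i(s,v)=\chi_i(v_i(s))\,v_i(s)-\int_0^{v_i(s)}\chi_i(t)\,dt$. **Theorem.** Let $d\ge 0$, and suppose that every valuation in every $V_i$ is monotone and $d$-critical. Then: 1. For all reports $(s,v)\in\mathbf S\times\mathbf V$, the candidate set can be partitioned into at most $d+1$ independent sets, so the mechanism is well defined. 2. Whichever such partitions are used, the Candidate Partitioning mechanism is feasible, has non-negative payments,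 is EPIC-IR, and is a $(d+1)$-approximation: $\mathrm{OPT}(s,v)\le (d+1)\sum_i x_i(s,v)v_i(s)$ for all $s\in\mathbf S$, $v\in\mathbf V$. 3. The ratio $d+1$ is tight, even for single-item auctions (at most one bidder is served): if $n\ge d+1$ and every signal space has at least two elements, then for every EPIC-IR single-item mechanism for the class of all monotone $d$-critical valuations there are a signal profile $s$ and monotone $d$-critical valuations $v$ with $\mathrm{OPT}(s,v)>0$ and $(d+1)\sum_i x_i(s,v)v_i(s)\le \mathrm{OPT}(s,v)$. -/

import Mathlib

open scoped NNReal

universe u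

namespace InterdependentAuction

/-- Signal profiles. Each signal space is ordered and its least element `⊥` is the zero signal. -/
abbrev SignalProfile {n : ℕ} (S : Fin n → Type u) : Type u := ∀ i, S i

/-- A valuation maps every signal profile to a non-negative value. -/
abbrev Valuation {n : ℕ} (S : Fin n → Type u) : Type u := SignalProfile S → ℝ≥0

section Valuations

variable {n : ℕ} {S : Fin n → Type u} [∀ i, PartialOrder (S i)] [∀ i, OrderBot (S i)]

/-- The profile `(s_{-i}, 0_i)`: the signal of bidder `i` is zeroed out. -/
def zeroOut (s : SignalProfile S) (i : Fin n) : SignalProfile S := Function.update s i ⊥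

/-- At every signal profile, zeroing out one signal lowers the value for at most `d` choices of
the bidder whose signal is zeroed out. -/
def IsCritical (d : ℕ) (v : Valuation S) : Prop :=
  ∀ s : SignalProfile S, (Finset.univ.filter fun j => v (zeroOut s j) < v s).card ≤ d

/-- The class of all monotone `d`-critical valuations. -/
def criticalValuations (S : Fin n → Type u) [∀ i, PartialOrder (S i)] [∀ i, OrderBot (S i)]
    (d : ℕ) : Set (Valuation S) :=
  {v | Monotone v ∧ IsCritical d v}

end Valuations

/-- A (randomized, direct-revelation) mechanism for the signal spaces `S i` and the valuation
spaces `V i`: the reported signals and valuations determine the distribution of the set of bidders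
that is served, and the payment of every bidder. -/
structure Mechanism {n : ℕ} (S : Fin n → Type u) (V : Fin n → Set (Valuation S)) where
  lottery : SignalProfile S → (∀ i, V i) → PMF (Finset (Fin n))
  payment : SignalProfile S → (∀ i, V i) → Fin n → ℝ

namespace Mechanism

variable {n : ℕ} {S : Fin n → Type u} {V : Fin n → Set (Valuation S)}

/-- The probability `x_i(s, v)` that bidder `i` is served. -/
noncomputable def alloc (A : Mechanism S V) (s : SignalProfile S) (v : ∀ i, V i) (i : Fin n) : ℝ :=
  ∑ I : Finset (Fin n) with i ∈ I, (A.lottery s v I).toReal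

/-- Only independent sets of the matroid are ever served. -/
def IsFeasible (A : Mechanism S V) (M : Matroid (Fin n)) : Prop :=
  ∀ s v, ∀ I ∈ (A.lottery s v).support, M.Indep (I : Set (Fin n))

/-- Ex-post incentive compatibility: no bidder `i` gains by reporting `(si, vi)` instead of her
true signal and valuation when all others report truthfully. -/
def IsEPIC (A : Mechanism S V) : Prop :=
  ∀ (i : Fin n) (s : SignalProfile S) (v : ∀ i, V i) (si : S i) (vi : V i),
    A.alloc (Function.update s i si) (Function.update v i vi) i * ((v i).1 s : ℝ)
        - A.payment (Function.update s i si) (Function.update v i vi) i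
      ≤ A.alloc s v i * ((v i).1 s : ℝ) - A.payment s v i

/-- Ex-post individual rationality. -/
def IsIR (A : Mechanism S V) : Prop :=
  ∀ (i : Fin n) (s : SignalProfile S) (v : ∀ i, V i),
    0 ≤ A.alloc s v i * ((v i).1 s : ℝ) - A.payment s v i

/-- Ex-post incentive compatible and individually rational. -/
def IsEPICIR (A : Mechanism S V) : Prop := A.IsEPIC ∧ A.IsIR

/-- The expected social welfare at truthful reports. -/
noncomputable def welfare (A : Mechanism S V) (s : SignalProfile S) (v : ∀ i, V i) : ℝ :=
  ∑ i, A.alloc s v i * ((v i).1 s : ℝ)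

end Mechanism

open Classical in
/-- The optimal welfare: the maximum total value of an independent set. -/
noncomputable def optWelfare {n : ℕ} {S : Fin n → Type u} {V : Fin n → Set (Valuation S)}
    (M : Matroid (Fin n)) (s : SignalProfile S) (v : ∀ i, V i) : ℝ≥0 :=
  (Finset.univ.filter fun I : Finset (Fin n) => M.Indep (I : Set (Fin n))).sup
    fun I => ∑ i ∈ I, (v i).1 s

/-- `A` is an `α`-approximation to the optimal welfare. -/
def Mechanism.IsApprox {n : ℕ} {S : Fin n → Type u} {V : Fin n → Set (Valuation S)}
    (A : Mechanism S V) (M : Matroid (Fin n)) (α : ℝ) : Prop :=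
  ∀ s v, (optWelfare M s v : ℝ) ≤ α * A.welfare s v

section Greedy

variable {n : ℕ}

/-- `i` is considered no later than `j`: decreasing weights, ties in favour of lower indices. -/
def Precedes (w : Fin n → ℝ) (i j : Fin n) : Prop := w j < w i ∨ (w i = w j ∧ i ≤ j)

open Classical in
/-- The greedy algorithm on the matroid `M` with weights `w`. -/
noncomputable def greedy (M : Matroid (Fin n)) (w : Fin n → ℝ) : Finset (Fin n) :=
  ((List.finRange n).insertionSort (Precedes w)).foldl
    (fun I j => if M.Indep (insert j (I : Set (Fin n))) then insert j I else I) ∅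

end Greedy

section CandidatePartitioning

variable {n : ℕ} {S : Fin n → Type u} [∀ i, PartialOrder (S i)] [∀ i, OrderBot (S i)]
  {V : Fin n → Set (Valuation S)}

/-- The weights used to examine bidder `i`: the number `t` for bidder `i` herself, and the shadow
value `v_j(s_{-i}, 0_i)` for every other bidder `j`. -/
noncomputable def examWeight (s : SignalProfile S) (v : ∀ i, V i) (i : Fin n) (t : ℝ) :
    Fin n → ℝ :=
  fun j => if j = i then t else ((v j).1 (zeroOut s i) : ℝ)

open Classical in
/-- The candidates: the bidders `i` selected by greedy when `i` is weighted by her real value and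
all others by their shadow values. -/
noncomputable def candidates (M : Matroid (Fin n)) (s : SignalProfile S) (v : ∀ i, V i) :
    Finset (Fin n) :=
  Finset.univ.filter fun i => i ∈ greedy M (examWeight s v i ((v i).1 s))

/-- `P` is a partition of the candidates into at most `d + 1` independent sets, written as a family
of exactly `d + 1` pairwise disjoint independent sets, some of which may be empty. -/
structure IsCandidatePartition (d : ℕ) (M : Matroid (Fin n)) (s : SignalProfile S) (v : ∀ i, V i)
    (P : Fin (d + 1) → Finset (Fin n)) : Prop where
  indep : ∀ k, M.Indep (P k : Set (Fin n))
  disjoint : Pairwise fun k l => Disjoint (P k) (P l)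
  cover : Finset.univ.biUnion P = candidates M s v

open Classical in
/-- The allocation probability `x_i(s_{-i}, v_{-i}, t)` of bidder `i` in the Candidate Partitioning
mechanism as a function of her value `t`: it is `1 / (d + 1)` if value `t` makes her a candidate. -/
noncomputable def candidateAlloc (d : ℕ) (M : Matroid (Fin n)) (s : SignalProfile S) (v : ∀ i, V i)
    (i : Fin n) (t : ℝ) : ℝ :=
  if i ∈ greedy M (examWeight s v i t) then 1 / ((d : ℝ) + 1) else 0

/-- The payment `x_i(v_i(s)) * v_i(s) - ∫_0^{v_i(s)} x_i(t) dt`. -/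
noncomputable def candidatePayment (d : ℕ) (M : Matroid (Fin n)) (s : SignalProfile S)
    (v : ∀ i, V i) (i : Fin n) : ℝ :=
  candidateAlloc d M s v i ((v i).1 s) * ((v i).1 s : ℝ)
    - ∫ t in (0 : ℝ)..((v i).1 s : ℝ), candidateAlloc d M s v i t

/-- The Candidate Partitioning mechanism, where `P s v` is the partition of the candidates that is
found at the reports `(s, v)`: each of the `d + 1` sets, the empty ones serving nobody, is served
with probability `1 / (d + 1)`. -/
noncomputable def candidatePartitioning (d : ℕ) (M : Matroid (Fin n))
    (P : SignalProfile S → (∀ i, V i) → Fin (d + 1) → Finset (Fin n)) : Mechanism S V where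
  lottery s v := (PMF.uniformOfFintype (Fin (d + 1))).map (P s v)
  payment s v i := candidatePayment d M s v i

end CandidatePartitioning

/-- The matroid of a single-item auction: at most one bidder can be served. -/
def singleItem (n : ℕ) : Matroid (Fin n) :=
  (IndepMatroid.ofFinset Set.univ (fun I : Finset (Fin n) => I.card ≤ 1)
    (by simp)
    (fun _ _ hJ hIJ => (Finset.card_le_card hIJ).trans hJ)
    (fun I J _ hJ hIJ => by
      obtain ⟨e, he, he'⟩ := Finset.exists_mem_notMem_of_card_lt_card hIJ
      refine ⟨e, he, he', ?_⟩
      have := Finset.card_insert_le e I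
      omega)
    (fun _ _ => Set.subset_univ _)).matroid

end InterdependentAuction

/-! Greedy selects `i` exactly when the elements ahead of `i` do not span it (`mem_greedy_iff`); the
upper bound follows from this. Partition: order bidders by true value and join `j` to a later `i`
when zeroing `i`'s signal lowers `j`'s value. Criticality leaves at most `d` forward edges per
vertex, so `d + 1` colours suffice. Inside a colour class, every `j` ahead of `i` keeps its value
when `i` is examined, hence is still ahead of `i`; as a candidate, `i` is not spanned by these, so
the class is independent. Welfare: shadow values never exceed true values, so every member of the
true greedy optimum is a candidate, and each candidate is served with probability `1 / (d + 1)`.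
Incentives: a bidder's allocation curve ignores her own report and is monotone in her value, so the
Myerson payments apply. Tightness: each of `d + 1` bidders values the item at 1 when the other `d`
have positive signals. One of them is served with probability at most `1 / (d + 1)`; zeroing her
signal makes the item worthless to everyone else, while incentive compatibility keeps her allocation
as low. -/

namespace InterdependentAuction

/-! ### Matroid spans and independence. -/

section Matroid

variable {α β : Type*} [LinearOrder β] {M : Matroid α}

/-- A set is independent as soon as, for some linear order, none of its elements is spanned by
the earlier ones. -/
lemma indep_of_forall_notMem_closure {I : Finset α} {f : α → β} (hf : Function.Injective f)
    (hE : (I : Set α) ⊆ M.E) (h : ∀ i ∈ I, i ∉ M.closure {j | j ∈ I ∧ f j < f i}) :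
    M.Indep (I : Set α) := by
  by_contra hI
  obtain ⟨C, hCI, hC⟩ := ((M.not_indep_iff hE).1 hI).exists_isCircuit_subset
  -- The last element of a circuit is spanned by the rest of it, all of which is earlier.
  obtain ⟨e, he, hmax⟩ := Set.exists_max_image C f (I.finite_toSet.subset hCI) hC.nonempty
  refine h e (hCI he) (M.closure_subset_closure ?_ (hC.mem_closure_sdiff_singleton_of_mem he))
  rintro j ⟨hj, hje⟩
  exact ⟨hCI hj, (hmax j hj).lt_of_ne fun hfj => hje (hf hfj)⟩

/-- An independent set that is contained in the span of a finite set has at most as many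
elements. -/
lemma card_le_card_of_subset_closure {I J : Finset α} (hI : M.Indep (I : Set α))
    (hIJ : (I : Set α) ⊆ M.closure J) : I.card ≤ J.card := by
  have h : (I : Set α).encard ≤ (J : Set α).encard :=
    (hI.encard_le_eRk_of_subset hIJ).trans
      ((M.eRk_closure_eq (J : Set α)).le.trans (M.eRk_le_encard (J : Set α)))
  simpa using h

end Matroid

/-! ### Colouring by forward degree. -/

/-- A graph in which every vertex is joined to at most `d` later vertices can be properly coloured
with `d + 1` colours. -/
lemma exists_coloring_of_card_le {α β : Type*} [Fintype α] [DecidableEq α] [LinearOrder β]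
    (d : ℕ) (f : α → β) (D : α → Finset α) (hD : ∀ j, (D j).card ≤ d) :
    ∃ c : α → Fin (d + 1), ∀ j i, f j < f i → i ∈ D j → c j ≠ c i := by
  suffices h : ∀ s : Finset α, ∃ c : α → Fin (d + 1),
      ∀ j ∈ s, ∀ i ∈ s, f j < f i → i ∈ D j → c j ≠ c i by
    obtain ⟨c, hc⟩ := h Finset.univ
    exact ⟨c, fun j i => hc j (Finset.mem_univ j) i (Finset.mem_univ i)⟩
  intro s
  -- Colour from the last vertex backwards: the new minimum `a` only has to avoid the at most `d`
  -- colours on `D a`, and no earlier vertex constrains it.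
  induction s using Finset.induction_on_min_value f with
  | empty => exact ⟨fun _ => 0, by simp⟩
  | insert a s has hmin ih =>
    obtain ⟨c, hc⟩ := ih
    obtain ⟨k, hk⟩ : ∃ k, k ∉ (D a).image c := by
      by_contra! hall
      have h1 : (Finset.univ : Finset (Fin (d + 1))).card ≤ ((D a).image c).card :=
        Finset.card_le_card fun k _ => hall k
      have h2 := h1.trans (Finset.card_image_le.trans (hD a))
      simp at h2
    refine ⟨Function.update c a k, fun j hj i hi hji hiD => ?_⟩
    have hia : i ≠ a := by
      rintro rfl
      rcases Finset.mem_insert.1 hj with rfl | hj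
      · exact hji.false
      · exact (hmin j hj).not_gt hji
    have his : i ∈ s := Finset.mem_of_mem_insert_of_ne hi hia
    rw [Function.update_of_ne hia]
    by_cases hja : j = a
    · subst hja
      rw [Function.update_self]
      rintro rfl
      exact hk (Finset.mem_image_of_mem c hiD)
    · rw [Function.update_of_ne hja]
      exact hc j (Finset.mem_of_mem_insert_of_ne hj hja) i his hji hiD

/-! ### The greedy algorithm: selection by span, optimality, monotonicity. -/

section Greedy

variable {n : ℕ} {w : Fin n → ℝ}

/-- Sorting key of the order in which the greedy algorithm considers the bidders. -/
def greedyKey (w : Fin n → ℝ) (i : Fin n) : Lex (ℝᵒᵈ × Fin n) := toLex (OrderDual.toDual (w i), i)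

lemma greedyKey_injective (w : Fin n → ℝ) : Function.Injective (greedyKey w) := fun _ _ h =>
  congrArg (fun x => (ofLex x).2) h

lemma precedes_iff {i j : Fin n} : Precedes w i j ↔ greedyKey w i ≤ greedyKey w j := by
  simp [Precedes, greedyKey, Prod.Lex.toLex_le_toLex]

lemma greedyKey_lt_iff {i j : Fin n} :
    greedyKey w i < greedyKey w j ↔ w j < w i ∨ (w i = w j ∧ i < j) := by
  simp [greedyKey, Prod.Lex.toLex_lt_toLex]

open Classical in
/-- One step of the greedy algorithm. -/
noncomputable def greedyStep (M : Matroid (Fin n)) (I : Finset (Fin n)) (j : Fin n) :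
    Finset (Fin n) :=
  if M.Indep (insert j (I : Set (Fin n))) then insert j I else I

variable {M : Matroid (Fin n)}

lemma greedyStep_eq_or (I : Finset (Fin n)) (j : Fin n) :
    greedyStep M I j = insert j I ∨ greedyStep M I j = I := by
  unfold greedyStep
  split_ifs <;> simp

lemma subset_foldl_greedyStep (l : List (Fin n)) (I : Finset (Fin n)) :
    I ⊆ l.foldl (greedyStep M) I := by
  induction l generalizing I with
  | nil => simp
  | cons a l ih =>
    refine subset_trans ?_ (ih _)
    rcases greedyStep_eq_or (M := M) I a with h | h <;> simp [h]

lemma mem_of_mem_foldl_greedyStep {l : List (Fin n)} {I : Finset (Fin n)} {i : Fin n}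
    (hi : i ∈ l.foldl (greedyStep M) I) : i ∈ I ∨ i ∈ l := by
  induction l generalizing I with
  | nil => exact .inl hi
  | cons a l ih =>
    rcases ih hi with h | h
    · rcases greedyStep_eq_or (M := M) I a with h' | h' <;> rw [h'] at h
      · rcases Finset.mem_insert.1 h with rfl | h
        · simp
        · exact .inl h
      · exact .inl h
    · simp [h]

lemma indep_greedyStep {I : Finset (Fin n)} (hI : M.Indep (I : Set (Fin n))) (j : Fin n) :
    M.Indep (greedyStep M I j : Set (Fin n)) := by
  unfold greedyStep
  split_ifs with h
  · simpa using h
  · exact hI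

/-- A rejected element is either already spanned or outside the ground set, where the closure
ignores it. So spans do not depend on greedy's decisions. -/
lemma closure_greedyStep {I : Finset (Fin n)} (hI : M.Indep (I : Set (Fin n))) (j : Fin n) :
    M.closure (greedyStep M I j : Set (Fin n)) = M.closure (insert j (I : Set (Fin n))) := by
  unfold greedyStep
  split_ifs with h
  · simp
  · by_cases hj : j ∈ M.E
    · refine (M.closure_insert_eq_of_mem_closure ?_).symm
      by_contra hcl
      exact h ((hI.notMem_closure_iff hj).1 hcl).1
    · rw [← M.closure_inter_ground (insert j _), Set.insert_inter_of_notMem hj,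
        M.closure_inter_ground]

lemma indep_foldl_greedyStep (l : List (Fin n)) {I : Finset (Fin n)}
    (hI : M.Indep (I : Set (Fin n))) :
    M.Indep ((l.foldl (greedyStep M) I : Finset (Fin n)) : Set (Fin n)) := by
  induction l generalizing I with
  | nil => exact hI
  | cons a l ih => exact ih (indep_greedyStep hI a)

lemma closure_foldl_greedyStep (l : List (Fin n)) {I : Finset (Fin n)}
    (hI : M.Indep (I : Set (Fin n))) :
    M.closure ((l.foldl (greedyStep M) I : Finset (Fin n)) : Set (Fin n)) =
      M.closure ((I : Set (Fin n)) ∪ {j | j ∈ l}) := by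
  induction l generalizing I with
  | nil => simp
  | cons a l ih =>
    rw [List.foldl_cons, ih (indep_greedyStep hI a),
      M.closure_union_congr_left (closure_greedyStep hI a)]
    congr 1
    ext j
    simp
    tauto

/-- Cuts greedy's run at `i`: the prefix is described by keys alone, and since `i` does not recur,
its fate is settled in a single step. -/
lemma exists_greedy_order (w : Fin n → ℝ) (i : Fin n) :
    ∃ l₁ l₂ : List (Fin n), (∀ M, greedy M w = (l₁ ++ i :: l₂).foldl (greedyStep M) ∅) ∧
      i ∉ l₂ ∧ ∀ j, j ∈ l₁ ↔ greedyKey w j < greedyKey w i := by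
  classical
  have hperm := List.perm_insertionSort (Precedes w) (List.finRange n)
  obtain ⟨l₁, l₂, hl⟩ := List.append_of_mem (hperm.mem_iff.2 (List.mem_finRange i))
  have : Std.Total (Precedes w) := ⟨fun a b => by
    simpa only [precedes_iff] using le_total _ _⟩
  have : IsTrans (Fin n) (Precedes w) := ⟨fun a b c => by
    simpa only [precedes_iff] using le_trans⟩
  have hsort := List.pairwise_insertionSort (Precedes w) (List.finRange n)
  have hnd := hperm.nodup_iff.2 (List.nodup_finRange n)
  have hmem : ∀ j, j ∈ (List.finRange n).insertionSort (Precedes w) :=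
    fun j => hperm.mem_iff.2 (List.mem_finRange j)
  refine ⟨l₁, l₂, fun M => ?_, ?_, fun j => ?_⟩
  · rw [← hl]
    unfold greedy greedyStep
    congr!
  · rw [hl] at hnd
    exact (List.nodup_cons.1 (List.nodup_append.1 hnd).2.1).1
  · rw [hl] at hsort hnd
    simp only [hl] at hmem
    obtain ⟨-, hs2, hs3⟩ := List.pairwise_append.1 hsort
    obtain ⟨-, -, hn3⟩ := List.nodup_append.1 hnd
    constructor
    · intro hj
      exact (precedes_iff.1 (hs3 j hj i (by simp))).lt_of_ne
        fun h => hn3 j hj i (by simp) (greedyKey_injective w h)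
    · intro hj
      rcases List.mem_append.1 (hmem j) with h | h
      · exact h
      · rcases List.mem_cons.1 h with rfl | h
        · exact absurd hj (lt_irrefl _)
        · exact absurd hj (precedes_iff.1 ((List.pairwise_cons.1 hs2).1 j h)).not_gt

/-- The greedy algorithm selects exactly the elements that are not spanned by the elements
considered before them. -/
lemma mem_greedy_iff {i : Fin n} :
    i ∈ greedy M w ↔ i ∈ M.E ∧ i ∉ M.closure {j | greedyKey w j < greedyKey w i} := by
  obtain ⟨l₁, l₂, hg, hi₂, hl⟩ := exists_greedy_order w i
  have hI := indep_foldl_greedyStep (M := M) l₁ (I := ∅) (by simp)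
  have hcl := closure_foldl_greedyStep (M := M) l₁ (I := ∅) (by simp)
  simp only [hl, Finset.coe_empty, Set.empty_union] at hcl
  have hi₁ : i ∉ l₁.foldl (greedyStep M) ∅ := fun h => by
    rcases mem_of_mem_foldl_greedyStep h with h | h
    · simp at h
    · exact lt_irrefl _ ((hl i).1 h)
  rw [← hcl, hg, List.foldl_append, List.foldl_cons]
  have hstep : i ∈ l₂.foldl (greedyStep M) (greedyStep M (l₁.foldl (greedyStep M) ∅) i) ↔
      i ∈ greedyStep M (l₁.foldl (greedyStep M) ∅) i :=
    ⟨fun h => (mem_of_mem_foldl_greedyStep h).resolve_right hi₂,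
      fun h => subset_foldl_greedyStep _ _ h⟩
  rw [hstep, ← Set.mem_sdiff, ← hI.insert_indep_iff_of_notMem (by simpa using hi₁)]
  generalize l₁.foldl (greedyStep M) ∅ = J at hi₁ ⊢
  unfold greedyStep
  split_ifs with h <;> simp [h, hi₁]

/-- Every element is spanned by the selected elements that are considered no later. -/
lemma mem_closure_greedy {i : Fin n} (hi : i ∈ M.E) :
    i ∈ M.closure {j | j ∈ greedy M w ∧ greedyKey w j ≤ greedyKey w i} := by
  obtain ⟨l₁, l₂, hg, -, hl⟩ := exists_greedy_order w i
  -- The run is stopped right after `i`, so that everything selected so far has key at most that of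
  -- `i`.
  have hcl := closure_foldl_greedyStep (M := M) (l₁ ++ [i]) (I := ∅) (by simp)
  have hmem : i ∈ M.closure (((∅ : Finset (Fin n)) : Set (Fin n)) ∪ {j | j ∈ l₁ ++ [i]}) :=
    M.mem_closure_of_mem' (by simp) hi
  rw [← hcl] at hmem
  refine M.closure_subset_closure (fun j hj => ?_) hmem
  rw [Finset.mem_coe] at hj
  constructor
  · rw [hg, List.append_cons, List.foldl_append]
    exact subset_foldl_greedyStep _ _ hj
  · rcases mem_of_mem_foldl_greedyStep hj with h | h
    · simp at h
    · rcases List.mem_append.1 h with h | h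
      · exact ((hl j).1 h).le
      · rw [List.mem_singleton.1 h]

/-- The greedy algorithm finds an independent set of maximum weight. -/
lemma sum_le_sum_greedy (hw : ∀ i, 0 ≤ w i) {I : Finset (Fin n)} (hI : M.Indep (I : Set (Fin n))) :
    ∑ i ∈ I, w i ≤ ∑ i ∈ greedy M w, w i := by
  classical
  let t : I → Finset (Fin n) := fun i =>
    (greedy M w).filter fun j => greedyKey w j ≤ greedyKey w i
  -- Hall's theorem matches `I` injectively to selected elements that are no later, hence no
  -- lighter. Hall's condition is a rank bound: a subset of `I` is independent and lies in the span
  -- of its combined neighbours.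
  obtain ⟨f, hf, hft⟩ := (Finset.all_card_le_biUnion_card_iff_exists_injective t).1 fun A => by
    rw [← Finset.card_map (Function.Embedding.subtype _) (s := A)]
    refine card_le_card_of_subset_closure (M := M) (hI.subset fun i hi => ?_) fun i hi => ?_
    · obtain ⟨a, -, rfl⟩ := Finset.mem_map.1 (Finset.mem_coe.1 hi)
      exact a.2
    · obtain ⟨a, ha, rfl⟩ := Finset.mem_map.1 (Finset.mem_coe.1 hi)
      refine M.closure_subset_closure (fun j hj => ?_)
        (mem_closure_greedy (w := w) (hI.subset_ground a.2))
      exact Finset.mem_coe.2 (Finset.mem_biUnion.2 ⟨a, ha, Finset.mem_filter.2 hj⟩)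
  have hle : ∀ i : I, w i ≤ w (f i) := fun i => by
    have h : Precedes w (f i) i := precedes_iff.2 (Finset.mem_filter.1 (hft i)).2
    exact h.elim le_of_lt fun h => h.1.ge
  calc ∑ i ∈ I, w i = ∑ i : I, w i := (Finset.sum_coe_sort I w).symm
    _ ≤ ∑ i : I, w (f i) := Finset.sum_le_sum fun i _ => hle i
    _ = ∑ j ∈ Finset.univ.image f, w j := (Finset.sum_image hf.injOn).symm
    _ ≤ ∑ j ∈ greedy M w, w j := by
        refine Finset.sum_le_sum_of_subset_of_nonneg (fun j hj => ?_) fun j _ _ => hw j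
        obtain ⟨i, -, rfl⟩ := Finset.mem_image.1 hj
        exact (Finset.mem_filter.1 (hft i)).1

/-- Raising the weight of a selected element and lowering the other weights keeps it selected. -/
lemma mem_greedy_of_le {w' : Fin n → ℝ} {i : Fin n} (hi : w i ≤ w' i)
    (hj : ∀ j, j ≠ i → w' j ≤ w j) (h : i ∈ greedy M w) : i ∈ greedy M w' := by
  rw [mem_greedy_iff] at h ⊢
  -- Whatever precedes `i` under `w'` already preceded it under `w`, so the span to be avoided only
  -- shrinks.
  refine ⟨h.1, fun hcl => h.2 (M.closure_subset_closure (fun j hji => ?_) hcl)⟩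
  rw [Set.mem_ofPred_eq, greedyKey_lt_iff] at hji ⊢
  have hne : j ≠ i := by
    rintro rfl
    simp at hji
  have := hj j hne
  rcases hji with h | ⟨h, h'⟩
  · exact .inl (by linarith)
  · rcases (show w i ≤ w j by linarith).lt_or_eq with h'' | h''
    · exact .inl h''
    · exact .inr ⟨h''.symm, h'⟩

end Greedy

/-! ### Candidates: partition, optimality, allocation curves. -/

section Candidates

variable {n : ℕ} {S : Fin n → Type u} [∀ i, PartialOrder (S i)] [∀ i, OrderBot (S i)]
  {V : Fin n → Set (Valuation S)} {d : ℕ} {M : Matroid (Fin n)}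

lemma zeroOut_le (s : SignalProfile S) (i : Fin n) : zeroOut s i ≤ s :=
  update_le_self_iff.2 bot_le

@[simp]
lemma zeroOut_update (s : SignalProfile S) (i : Fin n) (a : S i) :
    zeroOut (Function.update s i a) i = zeroOut s i := by
  simp [zeroOut]

@[simp]
lemma examWeight_self (s : SignalProfile S) (v : ∀ i, V i) (i : Fin n) (t : ℝ) :
    examWeight s v i t i = t := by
  simp [examWeight]

lemma examWeight_of_ne (s : SignalProfile S) (v : ∀ i, V i) {i j : Fin n} (h : j ≠ i) (t : ℝ) :
    examWeight s v i t j = (v j).1 (zeroOut s i) := by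
  simp [examWeight, h]

lemma mem_candidates {s : SignalProfile S} {v : ∀ i, V i} {i : Fin n} :
    i ∈ candidates M s v ↔ i ∈ greedy M (examWeight s v i ((v i).1 s)) := by
  simp [candidates]

lemma exists_isCandidatePartition (hV : ∀ i, V i ⊆ criticalValuations S d)
    (s : SignalProfile S) (v : ∀ i, V i) : ∃ P, IsCandidatePartition d M s v P := by
  classical
  let w : Fin n → ℝ := fun j => (v j).1 s
  obtain ⟨c, hc⟩ := exists_coloring_of_card_le d (greedyKey w)
    (fun j => Finset.univ.filter fun i => (v j).1 (zeroOut s i) < (v j).1 s)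
    (fun j => (hV j (v j).2).2 s)
  refine ⟨fun k => (candidates M s v).filter fun i => c i = k, fun k => ?_, fun k l hkl => ?_, ?_⟩
  · refine indep_of_forall_notMem_closure (greedyKey_injective w) (fun i hi => ?_) fun i hi => ?_
    · exact (mem_greedy_iff.1 (mem_candidates.1 (Finset.mem_filter.1 hi).1)).1
    · obtain ⟨hiC, hik⟩ := Finset.mem_filter.1 hi
      refine fun hcl => (mem_greedy_iff.1 (mem_candidates.1 hiC)).2
        (M.closure_subset_closure ?_ hcl)
      rintro j ⟨hj, hji⟩
      have hjk := (Finset.mem_filter.1 hj).2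
      have hne : j ≠ i := by
        rintro rfl
        exact lt_irrefl _ hji
      have hle : (v j).1 (zeroOut s i) ≤ (v j).1 s := (hV j (v j).2).1 (zeroOut_le s i)
      -- A strict drop would make `j → i` a forward edge, contradicting the shared colour.
      have heq : (v j).1 (zeroOut s i) = (v j).1 s := hle.antisymm <| not_lt.1 fun hlt =>
        hc j i hji (Finset.mem_filter.2 ⟨Finset.mem_univ i, hlt⟩) (hjk.trans hik.symm)
      rw [greedyKey_lt_iff] at hji
      rw [Set.mem_ofPred_eq, greedyKey_lt_iff, examWeight_self, examWeight_of_ne s v hne, heq]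
      exact hji
  · refine Finset.disjoint_left.2 fun i hi hi' => ?_
    exact hkl ((Finset.mem_filter.1 hi).2.symm.trans (Finset.mem_filter.1 hi').2)
  · ext i
    simp

lemma optWelfare_le_sum_candidates (hV : ∀ i, V i ⊆ criticalValuations S d)
    (s : SignalProfile S) (v : ∀ i, V i) :
    optWelfare M s v ≤ ∑ i ∈ candidates M s v, (v i).1 s := by
  classical
  refine Finset.sup_le fun I hI => ?_
  have hI' : M.Indep (I : Set (Fin n)) := (Finset.mem_filter.1 hI).2
  have h := sum_le_sum_greedy (w := fun i => ((v i).1 s : ℝ)) (fun i => NNReal.coe_nonneg _) hI'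
  have h' : ∑ i ∈ I, (v i).1 s ≤ ∑ i ∈ greedy M (fun i => ((v i).1 s : ℝ)), (v i).1 s := by
    exact_mod_cast h
  refine h'.trans (Finset.sum_le_sum_of_subset fun i hi => mem_candidates.2 ?_)
  refine mem_greedy_of_le (by simp) (fun j hj => ?_) hi
  rw [examWeight_of_ne s v hj]
  exact_mod_cast (hV j (v j).2).1 (zeroOut_le s i)

lemma candidateAlloc_nonneg (s : SignalProfile S) (v : ∀ i, V i) (i : Fin n) (t : ℝ) :
    0 ≤ candidateAlloc d M s v i t := by
  unfold candidateAlloc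
  split_ifs <;> positivity

lemma candidateAlloc_mono (s : SignalProfile S) (v : ∀ i, V i) (i : Fin n) :
    Monotone (candidateAlloc d M s v i) := by
  intro t t' htt'
  by_cases h : i ∈ greedy M (examWeight s v i t)
  · have h' : i ∈ greedy M (examWeight s v i t') :=
      mem_greedy_of_le (by simpa using htt')
        (fun j hj => by simp [examWeight_of_ne s v hj]) h
    simp [candidateAlloc, h, h']
  · have h0 : candidateAlloc d M s v i t = 0 := by simp [candidateAlloc, h]
    rw [h0]
    exact candidateAlloc_nonneg s v i t'

/-- The allocation of bidder `i` as a function of her value does not depend on her own report. -/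
lemma candidateAlloc_update (s : SignalProfile S) (v : ∀ i, V i) (i : Fin n) (a : S i) (b : V i) :
    candidateAlloc d M (Function.update s i a) (Function.update v i b) i =
      candidateAlloc d M s v i := by
  have h : ∀ t, examWeight (Function.update s i a) (Function.update v i b) i t =
      examWeight s v i t := fun t => by
    ext j
    by_cases hj : j = i
    · subst hj
      simp
    · simp [examWeight_of_ne _ _ hj, hj]
  ext t
  simp [candidateAlloc, h]

end Candidates

/-! ### Myerson payments and the guarantees of the mechanism. -/

/-- The integral of a monotone function lies above every tangent rectangle. -/
lemma mul_sub_le_integral_of_monotone {f : ℝ → ℝ} (hf : Monotone f) (a b : ℝ) :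
    f a * (b - a) ≤ ∫ t in a..b, f t := by
  rcases le_total a b with hab | hab
  · calc f a * (b - a) = ∫ _ in a..b, f a := by simp [mul_comm]
      _ ≤ ∫ t in a..b, f t := intervalIntegral.integral_mono_on hab
          intervalIntegrable_const hf.intervalIntegrable fun t ht => hf ht.1
  · have h : ∫ t in b..a, f t ≤ ∫ _ in b..a, f a := intervalIntegral.integral_mono_on hab
      hf.intervalIntegrable intervalIntegrable_const fun t ht => hf ht.2
    rw [intervalIntegral.integral_symm]
    simp only [intervalIntegral.integral_const, smul_eq_mul] at h
    linarith

section Mechanism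

variable {n : ℕ} {S : Fin n → Type u} {V : Fin n → Set (Valuation S)}

/-- Allocation probabilities as the probability of an event. -/
lemma Mechanism.alloc_eq_toOuterMeasure (A : Mechanism S V) (s : SignalProfile S) (v : ∀ i, V i)
    (i : Fin n) :
    A.alloc s v i = ((A.lottery s v).toOuterMeasure {I | i ∈ I}).toReal := by
  have h : {I : Finset (Fin n) | i ∈ I} =
      ((Finset.univ.filter fun I : Finset (Fin n) => i ∈ I : Finset (Finset (Fin n))) :
        Set (Finset (Fin n))) := by
    ext I
    simp
  rw [h, PMF.toOuterMeasure_apply_finset, ENNReal.toReal_sum fun I _ => PMF.apply_ne_top _ I]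
  rfl

lemma Mechanism.alloc_nonneg (A : Mechanism S V) (s : SignalProfile S) (v : ∀ i, V i)
    (i : Fin n) : 0 ≤ A.alloc s v i :=
  Finset.sum_nonneg fun _ _ => ENNReal.toReal_nonneg

variable [∀ i, PartialOrder (S i)] [∀ i, OrderBot (S i)] {d : ℕ} {M : Matroid (Fin n)}
  {P : SignalProfile S → (∀ i, V i) → Fin (d + 1) → Finset (Fin n)}

/-- By disjointness, a candidate lies in exactly one of the `d + 1` equally likely sets. -/
lemma candidatePartitioning_alloc (hP : ∀ s v, IsCandidatePartition d M s v (P s v))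
    (s : SignalProfile S) (v : ∀ i, V i) (i : Fin n) :
    (candidatePartitioning d M P).alloc s v i = candidateAlloc d M s v i ((v i).1 s) := by
  classical
  have hcov : i ∈ candidates M s v ↔ ∃ k, i ∈ P s v k := by
    rw [← (hP s v).cover]
    simp
  rw [Mechanism.alloc_eq_toOuterMeasure]
  change (((PMF.uniformOfFintype (Fin (d + 1))).map (P s v)).toOuterMeasure _).toReal = _
  rw [PMF.toOuterMeasure_map_apply]
  by_cases h : i ∈ candidates M s v
  · obtain ⟨k, hk⟩ := hcov.1 h
    have hset : P s v ⁻¹' {I | i ∈ I} = (({k} : Finset (Fin (d + 1))) : Set (Fin (d + 1))) := by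
      ext l
      simp only [Set.mem_preimage, Set.mem_ofPred_eq, Finset.coe_singleton, Set.mem_singleton_iff]
      refine ⟨fun hl => ?_, fun hl => hl ▸ hk⟩
      by_contra hne
      exact Finset.disjoint_left.1 ((hP s v).disjoint hne) hl hk
    rw [hset, PMF.toOuterMeasure_apply_finset]
    rw [mem_candidates] at h
    have hd : ((d : ENNReal) + 1).toReal = d + 1 := by
      rw [ENNReal.toReal_add (by simp) (by simp)]
      simp
    simp [candidateAlloc, h, hd]
  · have hset : P s v ⁻¹' {I | i ∈ I} = ∅ := by
      ext l
      simpa using fun hl => h (hcov.2 ⟨l, hl⟩)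
    rw [hset]
    rw [mem_candidates] at h
    simp [candidateAlloc, h]

lemma candidatePartitioning_isFeasible (hP : ∀ s v, IsCandidatePartition d M s v (P s v)) :
    (candidatePartitioning d M P).IsFeasible M := by
  intro s v I hI
  obtain ⟨k, -, rfl⟩ := (PMF.mem_support_map_iff _ _ _).1 hI
  exact (hP s v).indep k

lemma candidatePayment_nonneg (s : SignalProfile S) (v : ∀ i, V i) (i : Fin n) :
    0 ≤ candidatePayment d M s v i := by
  have h := mul_sub_le_integral_of_monotone (candidateAlloc_mono (d := d) (M := M) s v i)
    ((v i).1 s) 0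
  rw [intervalIntegral.integral_symm] at h
  unfold candidatePayment
  linarith

lemma candidatePartitioning_isEPICIR (hP : ∀ s v, IsCandidatePartition d M s v (P s v)) :
    (candidatePartitioning d M P).IsEPICIR := by
  have hpay : ∀ s v i, (candidatePartitioning d M P).payment s v i = candidatePayment d M s v i :=
    fun _ _ _ => rfl
  refine ⟨fun i s v si vi => ?_, fun i s v => ?_⟩
  · simp only [candidatePartitioning_alloc hP, hpay, candidatePayment, candidateAlloc_update]
    set χ := candidateAlloc d M s v i
    set t : ℝ := ((v i).1 s : ℝ)
    set t' : ℝ := ((Function.update v i vi i).1 (Function.update s i si) : ℝ)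
    have hmono : Monotone χ := candidateAlloc_mono s v i
    -- A misreport of signal and valuation matters only through the reported value `t'`. The utility
    -- lost is the integral of `χ` from `t'` to `t` minus `χ t' * (t - t')`, nonnegative by
    -- monotonicity.
    have h := mul_sub_le_integral_of_monotone hmono t' t
    have hadd := intervalIntegral.integral_add_adjacent_intervals
      (hmono.intervalIntegrable (μ := MeasureTheory.volume) (a := 0) (b := t'))
      (hmono.intervalIntegrable (b := t))
    linarith
  · simp only [candidatePartitioning_alloc hP, hpay, candidatePayment, sub_sub_cancel]
    exact intervalIntegral.integral_nonneg (NNReal.coe_nonneg _)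
      fun t _ => candidateAlloc_nonneg s v i t

lemma candidatePartitioning_isApprox (hV : ∀ i, V i ⊆ criticalValuations S d)
    (hP : ∀ s v, IsCandidatePartition d M s v (P s v)) :
    (candidatePartitioning d M P).IsApprox M (d + 1) := by
  classical
  intro s v
  have h : (optWelfare M s v : ℝ) ≤ ∑ i ∈ candidates M s v, ((v i).1 s : ℝ) := by
    exact_mod_cast optWelfare_le_sum_candidates hV s v
  refine h.trans_eq ?_
  unfold Mechanism.welfare candidates
  rw [Finset.mul_sum, Finset.sum_filter]
  refine Finset.sum_congr rfl fun i _ => ?_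
  rw [candidatePartitioning_alloc hP, candidateAlloc]
  split_ifs
  · field_simp
  · simp

end Mechanism

/-! ### Tightness for single-item auctions. -/

section LowerBound

variable {n : ℕ} {S : Fin n → Type u}

lemma singleItem_indep_iff {I : Finset (Fin n)} :
    (singleItem n).Indep (I : Set (Fin n)) ↔ I.card ≤ 1 :=
  ⟨fun h => h I subset_rfl, fun h _ hJ => (Finset.card_le_card (Finset.coe_subset.1 hJ)).trans h⟩

/-- A single-item mechanism serves one bidder in expectation at most. -/
lemma Mechanism.sum_alloc_le_one {V : Fin n → Set (Valuation S)} {A : Mechanism S V}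
    (hA : A.IsFeasible (singleItem n)) (s : SignalProfile S) (v : ∀ i, V i) :
    ∑ i, A.alloc s v i ≤ 1 := by
  have hsum : ∑ I : Finset (Fin n), (A.lottery s v I).toReal = 1 := by
    rw [← ENNReal.toReal_sum fun I _ => PMF.apply_ne_top _ I,
      ← tsum_fintype (L := .unconditional _), PMF.tsum_coe, ENNReal.toReal_one]
  calc ∑ i, A.alloc s v i
      = ∑ I : Finset (Fin n), ∑ i ∈ I, (A.lottery s v I).toReal := by
        unfold Mechanism.alloc
        exact Finset.sum_comm' (by simp)
    _ ≤ ∑ I : Finset (Fin n), (A.lottery s v I).toReal := by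
        refine Finset.sum_le_sum fun I _ => ?_
        rw [Finset.sum_const, nsmul_eq_mul]
        by_cases hI : A.lottery s v I = 0
        · simp [hI]
        · have hcard : (I.card : ℝ) ≤ 1 := by
            exact_mod_cast singleItem_indep_iff.1 (hA s v I ((PMF.mem_support_iff _ _).2 hI))
          exact mul_le_of_le_one_left ENNReal.toReal_nonneg hcard
    _ = 1 := hsum

/-- In an incentive compatible mechanism, a bidder who changes her type so that her value drops
does not gain allocation. -/
lemma Mechanism.IsEPIC.alloc_update_le {V : Fin n → Set (Valuation S)} {A : Mechanism S V}
    (hA : A.IsEPIC) {i : Fin n} {s : SignalProfile S} {v : ∀ i, V i} {a : S i} {b : V i}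
    (h : b.1 (Function.update s i a) < (v i).1 s) :
    A.alloc (Function.update s i a) (Function.update v i b) i ≤ A.alloc s v i := by
  -- Adding the two constraints between the types cancels payments and leaves a nonnegative product
  -- of allocation difference and value difference.
  have h₁ := hA i s v a b
  have h₂ := hA i (Function.update s i a) (Function.update v i b) (s i) (v i)
  simp only [Function.update_idem, Function.update_eq_self, Function.update_self] at h₂
  have h' : (b.1 (Function.update s i a) : ℝ) < (v i).1 s := by exact_mod_cast h
  nlinarith

variable [∀ i, PartialOrder (S i)] [∀ i, OrderBot (S i)]

open Classical in
/-- The valuation that is `1` if all bidders of `T` have a positive signal, and `0` otherwise. -/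
noncomputable def indicatorValuation (T : Finset (Fin n)) : Valuation S :=
  fun s => if ∀ k ∈ T, s k ≠ ⊥ then 1 else 0

/-- Zeroing a signal outside `T` changes nothing, so only members of `T` can be critical. -/
lemma indicatorValuation_mem {d : ℕ} {T : Finset (Fin n)} (hT : T.card ≤ d) :
    indicatorValuation T ∈ criticalValuations S d := by
  classical
  refine ⟨fun s s' hs => ?_, fun s => (Finset.card_le_card fun j hj => ?_).trans hT⟩
  · by_cases h : ∀ k ∈ T, s k ≠ ⊥
    · have h' : ∀ k ∈ T, s' k ≠ ⊥ := fun k hk hbot => h k hk (le_bot_iff.1 (hbot ▸ hs k))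
      simp only [indicatorValuation, if_pos h, if_pos h', le_refl]
    · simp only [indicatorValuation, if_neg h, zero_le]
  · by_contra hjT
    have heq : indicatorValuation T (zeroOut s j) = indicatorValuation T s := by
      have : ∀ k ∈ T, zeroOut s j k = s k := fun k hk =>
        Function.update_of_ne (ne_of_mem_of_not_mem hk hjT) _ _
      unfold indicatorValuation
      congr 1
      exact propext (forall₂_congr fun k hk => by rw [this k hk])
    exact (Finset.mem_filter.1 hj).2.ne heq

lemma const_mem_criticalValuations (d : ℕ) (c : ℝ≥0) :
    (fun _ => c) ∈ criticalValuations S d :=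
  ⟨fun _ _ _ => le_rfl, fun s => by simp⟩

lemma singleItem_tight {d : ℕ} (hdn : d + 1 ≤ n) (hS : ∀ i, Nontrivial (S i))
    (A : Mechanism S (fun _ => criticalValuations S d)) (hF : A.IsFeasible (singleItem n))
    (hA : A.IsEPIC) :
    ∃ s v, 0 < optWelfare (singleItem n) s v ∧
      ((d : ℝ) + 1) * A.welfare s v ≤ optWelfare (singleItem n) s v := by
  classical
  obtain ⟨T, -, hT⟩ := Finset.exists_subset_card_eq (s := (Finset.univ : Finset (Fin n)))
    (n := d + 1) (by simpa using hdn)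
  choose s hs using fun i => exists_ne (⊥ : S i)
  let v : ∀ _ : Fin n, criticalValuations S d := fun j =>
    if h : j ∈ T then ⟨indicatorValuation (T.erase j),
      indicatorValuation_mem (by rw [Finset.card_erase_of_mem h, hT, Nat.add_sub_cancel])⟩
    else ⟨fun _ => 0, const_mem_criticalValuations d 0⟩
  obtain ⟨i, hiT, hi⟩ : ∃ i ∈ T, A.alloc s v i ≤ 1 / ((d : ℝ) + 1) := by
    by_contra! h
    have h₁ : ∑ _i ∈ T, 1 / ((d : ℝ) + 1) < ∑ i ∈ T, A.alloc s v i :=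
      Finset.sum_lt_sum_of_nonempty (Finset.card_pos.1 (by omega)) h
    have h₂ : ∑ i ∈ T, A.alloc s v i ≤ ∑ i, A.alloc s v i :=
      Finset.sum_le_sum_of_subset_of_nonneg (Finset.subset_univ T)
        fun j _ _ => A.alloc_nonneg s v j
    have h₃ := Mechanism.sum_alloc_le_one hF s v
    rw [Finset.sum_const, hT, nsmul_eq_mul] at h₁
    push_cast at h₁
    rw [mul_one_div_cancel (by positivity)] at h₁
    linarith
  -- Any constant strictly between 0 and 1 would do: below her old value 1, so that her allocation
  -- cannot rise, and positive, so that the optimum is positive.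
  let b : criticalValuations S d := ⟨fun _ => 1 / 2, const_mem_criticalValuations d _⟩
  let s' := Function.update s i ⊥
  let v' := Function.update v i b
  have hval : ∀ j, j ≠ i → (v' j).1 s' = 0 := fun j hj => by
    simp only [v', Function.update_of_ne hj, v]
    split_ifs with hjT
    · have : ¬ ∀ k ∈ T.erase j, s' k ≠ ⊥ := fun h =>
        h i (Finset.mem_erase.2 ⟨hj.symm, hiT⟩) (Function.update_self ..)
      simp only [indicatorValuation, if_neg this]
    · rfl
  have hvali : (v' i).1 s' = 1 / 2 := by simp [v', b]
  have hvi : (v i).1 s = 1 := by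
    simp only [v, dif_pos hiT, indicatorValuation]
    exact if_pos fun k _ => hs k
  have halloc : A.alloc s' v' i ≤ 1 / ((d : ℝ) + 1) :=
    (hA.alloc_update_le (by
      rw [hvi]
      exact NNReal.half_lt_self one_ne_zero)).trans hi
  have hopt : 1 / 2 ≤ optWelfare (singleItem n) s' v' := by
    have hmem : ({i} : Finset (Fin n)) ∈
        Finset.univ.filter fun I : Finset (Fin n) => (singleItem n).Indep (I : Set (Fin n)) :=
      Finset.mem_filter.2 ⟨Finset.mem_univ _, singleItem_indep_iff.2 (by simp)⟩
    have := Finset.le_sup (f := fun I : Finset (Fin n) => ∑ j ∈ I, (v' j).1 s') hmem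
    rw [Finset.sum_singleton, hvali] at this
    unfold optWelfare
    convert this
  have hwel : A.welfare s' v' = A.alloc s' v' i * (1 / 2) := by
    unfold Mechanism.welfare
    rw [Finset.sum_eq_single i (fun j _ hj => by simp [hval j hj]) (by simp), hvali]
    simp
  refine ⟨s', v', lt_of_lt_of_le (by norm_num) hopt, ?_⟩
  have hopt' : (1 / 2 : ℝ) ≤ optWelfare (singleItem n) s' v' := by exact_mod_cast hopt
  refine le_trans ?_ hopt'
  rw [le_div_iff₀ (by positivity)] at halloc
  rw [hwel]
  linarith

end LowerBound

end InterdependentAuction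

open InterdependentAuction in
theorem theorem4p1 (d n : ℕ) (S : Fin n → Type u)
    [∀ i, PartialOrder (S i)] [∀ i, OrderBot (S i)]
    (V : Fin n → Set (Valuation S)) (hV : ∀ i, V i ⊆ criticalValuations S d)
    (M : Matroid (Fin n)) :
    -- the mechanism is well defined: the candidates can always be partitioned as required
    (∀ (s : SignalProfile S) (v : ∀ i, V i), ∃ P, IsCandidatePartition d M s v P) ∧
    -- whichever partitions are used, it is feasible, EPIC-IR and a `(d + 1)`-approximation
    (∀ P : SignalProfile S → (∀ i, V i) → Fin (d + 1) → Finset (Fin n),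
      (∀ s v, IsCandidatePartition d M s v (P s v)) →
        (candidatePartitioning d M P).IsFeasible M ∧
        (∀ s v i, 0 ≤ (candidatePartitioning d M P).payment s v i) ∧
        (candidatePartitioning d M P).IsEPICIR ∧
        (candidatePartitioning d M P).IsApprox M (d + 1)) ∧
    -- tightness: no EPIC-IR single-item auction for `d`-critical valuations has a better ratio
    (d + 1 ≤ n → (∀ i, Nontrivial (S i)) →
      ∀ A : Mechanism S (fun _ => criticalValuations S d),
        A.IsFeasible (singleItem n) → A.IsEPICIR →
          ∃ s v, 0 < optWelfare (singleItem n) s v ∧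
            ((d : ℝ) + 1) * A.welfare s v ≤ optWelfare (singleItem n) s v) :=
  ⟨fun s v => exists_isCandidatePartition hV s v,
    fun _ hP => ⟨candidatePartitioning_isFeasible hP, fun s v i => candidatePayment_nonneg s v i,
      candidatePartitioning_isEPICIR hP, candidatePartitioning_isApprox hV hP⟩,
    fun hdn hS A hF hA => singleItem_tight hdn hS A hF hA.1⟩
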